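/- Let $\mathsf{Met}$ be the category of extended metric spaces (distances take values in $[0,\infty]$; the empty space is allowed) and non-expanding maps, i.e. maps $f$ with $d(f(x),f(x'))\le d(x,x')$, and let $\mathsf{CMS}$ be its full subcategory of complete spaces. The Hausdorff functor $\mathcal H\colon\mathsf{Met}\to\mathsf{Met}$ assigns to $X$ the set of all compact subsets of $X$ (including $\emptyset$) with the Hausdorff distance $$\bar d(S,T)=\max\Bigl(\sup_{x\in S}d(x,T),\ \sup_{y\in T}d(y,S)\Bigr),\qquad d(x,T)=\inf_{y\in T}d(x,y),$$ and to $f\colon X\to Y$ the map $S\mapsto f[S]$. The Hausdorff polynomial functors on $\mathsf{Met}$ are the endofunctors built according to the grammar $$F ::= \mathcal H \mid A \mid \mathrm{Id} \mid \prod_{i\in I}F_i \mid \coprod_{i\in I}F_i \mid FF,$$ where $A$ ranges over (the constant functors on) all extended metric spaces and $I$ over arbitrary index sets; products carry the supremum distance, and in coproducts (disjoint unions) points of different summands have distance $\infty$. If all constants $A$ used in building $F$ are complete, $F$ restricts to an endofunctor of $\mathsf{CMS}$; these restrictions are the Hausdorff polynomial functors on $\mathsf{CMS}$. **Corollary.**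 Every Hausdorff polynomial functor $F$ on $\mathsf{Met}$ has an initial algebra, and every Hausdorff polynomial functor $F$ on $\mathsf{CMS}$ has an initial algebra. -/

import Mathlib

open CategoryTheory CategoryTheory.Limits
open scoped ENNReal

universe u

noncomputable section

/-! ### The category of extended metric spaces -/

/-- A non-expanding map between extended metric spaces. -/
@[ext]
structure NonexpandingMap (X Y : Type*) [EMetricSpace X] [EMetricSpace Y] where
  toFun : X → Y
  edist_le' : ∀ x x', edist (toFun x) (toFun x') ≤ edist x x'

namespace NonexpandingMap

instance (X Y : Type*) [EMetricSpace X] [EMetricSpace Y] :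
    FunLike (NonexpandingMap X Y) X Y where
  coe := toFun
  coe_injective _ _ h := NonexpandingMap.ext h

variable {X Y : Type*} [EMetricSpace X] [EMetricSpace Y]

theorem edist_le (f : NonexpandingMap X Y) (x x' : X) : edist (f x) (f x') ≤ edist x x' :=
  f.edist_le' x x'

theorem lipschitz (f : NonexpandingMap X Y) : LipschitzWith 1 f := fun x x' => by
  simpa using f.edist_le x x'

end NonexpandingMap

/-- The objects of the category `Met`: extended metric spaces, i.e. distances take values in
`[0, ∞]`, satisfy the metric axioms, and distinct points have nonzero distance. -/
structure Met : Type (u + 1) where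
  of ::
  carrier : Type u
  [str : EMetricSpace carrier]

attribute [instance] Met.str

namespace Met

instance : CoeSort Met.{u} (Type u) := ⟨carrier⟩

/-- The morphisms of `Met` are the non-expanding maps. -/
@[ext]
structure Hom (X Y : Met.{u}) where
  hom' : NonexpandingMap X Y

instance : LargeCategory.{u} Met.{u} where
  Hom X Y := Hom X Y
  id _ := ⟨⟨fun x => x, fun _ _ => le_rfl⟩⟩
  comp f g :=
    ⟨⟨fun x => g.hom' (f.hom' x), fun x x' => (g.hom'.edist_le _ _).trans (f.hom'.edist_le x x')⟩⟩

instance : ConcreteCategory Met.{u} (fun X Y => NonexpandingMap X Y) where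
  hom f := f.hom'
  ofHom f := ⟨f⟩

theorem edist_le {X Y : Met.{u}} (f : X ⟶ Y) (x x' : X) : edist (f x) (f x') ≤ edist x x' :=
  f.hom'.edist_le x x'

theorem continuous {X Y : Met.{u}} (f : X ⟶ Y) : Continuous f := f.hom'.lipschitz.continuous

end Met

/-! ### The Hausdorff functor -/

/-- The Hausdorff functor: `X` is mapped to the set of all compact subsets of `X` (including the
empty one) with the Hausdorff distance, and `f` to the direct image map `S ↦ f[S]`. -/
def hausdorffFunctor : Met.{u} ⥤ Met.{u} where
  obj X := Met.of (TopologicalSpace.Compacts X)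
  map {X Y} f := ConcreteCategory.ofHom
    { toFun := fun S => S.map f (Met.continuous f)
      edist_le' := fun S T => by
        have key : ∀ (S T : Set X), ∀ y ∈ f '' S,
            Metric.infEDist y (f '' T) ≤ Metric.hausdorffEDist S T := by
          rintro S T _ ⟨x, hx, rfl⟩
          refine le_trans ?_ (Metric.infEDist_le_hausdorffEDist_of_mem hx)
          refine le_iInf₂ fun z hz => ?_
          exact (Metric.infEDist_le_edist_of_mem (Set.mem_image_of_mem f hz)).trans
            (Met.edist_le f x z)
        refine Metric.hausdorffEDist_le_of_infEDist (key S T) ?_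
        intro y hy
        exact (key T S y hy).trans Metric.hausdorffEDist_comm.le }
  map_id X := ConcreteCategory.hom_ext _ _ fun S =>
    TopologicalSpace.Compacts.ext (Set.image_id S.carrier)
  map_comp f g := ConcreteCategory.hom_ext _ _ fun S =>
    TopologicalSpace.Compacts.ext (Set.image_comp g f S.carrier)

/-! ### Products -/

/-- The product of a family of extended metric spaces, with the supremum distance. -/
@[ext]
structure MetProd {I : Type u} (X : I → Met.{u}) : Type u where
  val : ∀ i, X i

instance {I : Type u} (X : I → Met.{u}) : EMetricSpace (MetProd X) where
  edist x y := ⨆ i, edist (x.val i) (y.val i)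
  edist_self x := by simp
  edist_comm x y := by simp [edist_comm]
  edist_triangle x y z := iSup_le fun i =>
    (edist_triangle (x.val i) (y.val i) (z.val i)).trans
      (add_le_add (le_iSup (fun i => edist (x.val i) (y.val i)) i)
        (le_iSup (fun i => edist (y.val i) (z.val i)) i))
  eq_of_edist_eq_zero {x y} h := MetProd.ext <| funext fun i =>
    edist_le_zero.1 ((le_iSup (fun i => edist (x.val i) (y.val i)) i).trans h.le)

theorem MetProd.edist_eq {I : Type u} {X : I → Met.{u}} (x y : MetProd X) :
    edist x y = ⨆ i, edist (x.val i) (y.val i) := rfl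

theorem MetProd.edist_val_le {I : Type u} {X : I → Met.{u}} (x y : MetProd X) (i : I) :
    edist (x.val i) (y.val i) ≤ edist x y :=
  le_iSup (fun i => edist (x.val i) (y.val i)) i

/-- The pointwise product of a family of endofunctors of `Met`. -/
def prodFunctor {I : Type u} (F : I → Met.{u} ⥤ Met.{u}) : Met.{u} ⥤ Met.{u} where
  obj X := Met.of (MetProd fun i => (F i).obj X)
  map f := ConcreteCategory.ofHom
    { toFun := fun x => ⟨fun i => (F i).map f (x.val i)⟩
      edist_le' := fun x y => iSup_le fun i =>
        (Met.edist_le ((F i).map f) _ _).trans (MetProd.edist_val_le x y i) }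
  map_id X := ConcreteCategory.hom_ext _ _ fun x => MetProd.ext <| funext fun i =>
    ConcreteCategory.congr_hom ((F i).map_id X) (x.val i)
  map_comp f g := ConcreteCategory.hom_ext _ _ fun x => MetProd.ext <| funext fun i =>
    ConcreteCategory.congr_hom ((F i).map_comp f g) (x.val i)

/-! ### Coproducts -/

/-- The coproduct (disjoint union) of a family of extended metric spaces: each summand keeps its
distance, and points of different summands have distance `∞`. -/
structure MetCoprod {I : Type u} (X : I → Met.{u}) : Type u where
  idx : I
  val : X idx

namespace MetCoprod

variable {I : Type u} {X : I → Met.{u}}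

open Classical in
instance : EDist (MetCoprod X) where
  edist p q := if h : p.idx = q.idx then edist (h ▸ p.val : X q.idx) q.val else ⊤

@[simp]
theorem edist_same (i : I) (x y : X i) :
    edist (⟨i, x⟩ : MetCoprod X) ⟨i, y⟩ = edist x y := by
  change @dite _ _ (Classical.propDecidable _) _ _ = _
  simp

theorem edist_ne {i j : I} (h : i ≠ j) (x : X i) (y : X j) :
    edist (⟨i, x⟩ : MetCoprod X) ⟨j, y⟩ = ⊤ := by
  change @dite _ _ (Classical.propDecidable _) _ _ = _
  simp [h]

theorem idx_eq_of_edist_ne_top {p q : MetCoprod X} (h : edist p q ≠ ⊤) : p.idx = q.idx :=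
  by_contra fun hne => h (edist_ne hne p.val q.val)

instance : EMetricSpace (MetCoprod X) where
  edist_self := by
    rintro ⟨i, x⟩
    simp
  edist_comm := by
    rintro ⟨i, x⟩ ⟨j, y⟩
    by_cases h : i = j
    · subst h
      simp [edist_comm]
    · rw [edist_ne h, edist_ne (Ne.symm h)]
  edist_triangle := by
    rintro ⟨i, x⟩ ⟨j, y⟩ ⟨k, z⟩
    by_cases h : i = j
    · subst h
      by_cases h' : i = k
      · subst h'
        simpa using edist_triangle x y z
      · simp [edist_ne h']
    · simp [edist_ne h]
  eq_of_edist_eq_zero := by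
    rintro ⟨i, x⟩ ⟨j, y⟩ h
    by_cases h' : i = j
    · subst h'
      rw [edist_same] at h
      rw [eq_of_edist_eq_zero h]
    · simp [edist_ne h'] at h

end MetCoprod

/-- The pointwise coproduct of a family of endofunctors of `Met`. -/
def coprodFunctor {I : Type u} (F : I → Met.{u} ⥤ Met.{u}) : Met.{u} ⥤ Met.{u} where
  obj X := Met.of (MetCoprod fun i => (F i).obj X)
  map f := ConcreteCategory.ofHom
    { toFun := fun p => ⟨p.idx, (F p.idx).map f p.val⟩
      edist_le' := by
        rintro ⟨i, x⟩ ⟨j, y⟩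
        by_cases h : i = j
        · subst h
          simpa using Met.edist_le ((F i).map f) x y
        · simp [MetCoprod.edist_ne h] }
  map_id X := ConcreteCategory.hom_ext _ _ fun p => congrArg (MetCoprod.mk p.idx)
    (ConcreteCategory.congr_hom ((F p.idx).map_id X) p.val)
  map_comp f g := ConcreteCategory.hom_ext _ _ fun p => congrArg (MetCoprod.mk p.idx)
    (ConcreteCategory.congr_hom ((F p.idx).map_comp f g) p.val)

/-! ### Hausdorff polynomial functors -/

/-- The grammar `F ::= H | A | Id | ∏ F_i | ∐ F_i | F F` of Hausdorff polynomial functors. -/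
inductive HausdorffExpr : Type (u + 1)
  | hausdorff : HausdorffExpr
  | const (A : Met.{u}) : HausdorffExpr
  | id : HausdorffExpr
  | prod (I : Type u) (F : I → HausdorffExpr) : HausdorffExpr
  | coprod (I : Type u) (F : I → HausdorffExpr) : HausdorffExpr
  | comp (F G : HausdorffExpr) : HausdorffExpr

namespace HausdorffExpr

/-- The endofunctor of `Met` denoted by an expression; `comp F G` denotes `X ↦ F (G X)`. -/
def functor : HausdorffExpr.{u} → Met.{u} ⥤ Met.{u}
  | hausdorff => hausdorffFunctor
  | const A => (Functor.const Met.{u}).obj A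
  | id => 𝟭 Met.{u}
  | prod _ F => prodFunctor fun i => (F i).functor
  | coprod _ F => coprodFunctor fun i => (F i).functor
  | comp F G => G.functor ⋙ F.functor

/-- All constants occurring in the expression are complete spaces. -/
def CompleteConstants : HausdorffExpr.{u} → Prop
  | hausdorff => True
  | const A => CompleteSpace A
  | id => True
  | prod _ F => ∀ i, (F i).CompleteConstants
  | coprod _ F => ∀ i, (F i).CompleteConstants
  | comp F G => F.CompleteConstants ∧ G.CompleteConstants

end HausdorffExpr

/-- An endofunctor of `Met` is Hausdorff polynomial if it is (up to natural isomorphism) denoted by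
an expression of the grammar. -/
def IsHausdorffPolynomial (F : Met.{u} ⥤ Met.{u}) : Prop :=
  ∃ e : HausdorffExpr.{u}, Nonempty (F ≅ e.functor)

/-! ### Complete spaces -/

/-- Completeness of an extended metric space. -/
def Met.isComplete : ObjectProperty Met.{u} := fun X => CompleteSpace X

/-- The full subcategory `CMS` of `Met` given by the complete spaces. -/
abbrev CMS : Type (u + 1) := Met.isComplete.{u}.FullSubcategory

theorem MetProd.completeSpace {I : Type u} {X : I → Met.{u}} (hX : ∀ i, CompleteSpace (X i)) :
    CompleteSpace (MetProd X) := by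
  refine EMetric.complete_of_cauchySeq_tendsto fun s hs => ?_
  rw [EMetric.cauchySeq_iff] at hs
  have hc : ∀ i, CauchySeq fun n => (s n).val i := fun i => EMetric.cauchySeq_iff.2 fun ε hε => by
    obtain ⟨N, hN⟩ := hs ε hε
    exact ⟨N, fun m hm n hn => (MetProd.edist_val_le _ _ i).trans_lt (hN m hm n hn)⟩
  choose a ha using fun i => cauchySeq_tendsto_of_complete (hc i)
  refine ⟨⟨a⟩, EMetric.tendsto_atTop.2 fun ε hε => ?_⟩
  obtain ⟨δ, hδ, hδε⟩ := exists_between hε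
  obtain ⟨N, hN⟩ := hs δ hδ
  refine ⟨N, fun n hn => lt_of_le_of_lt (iSup_le fun i => ?_) hδε⟩
  refine le_of_tendsto (tendsto_const_nhds.edist (ha i)) (Filter.eventually_atTop.2 ⟨N, ?_⟩)
  exact fun m hm => ((MetProd.edist_val_le _ _ i).trans_lt (hN n hn m hm)).le

theorem MetCoprod.completeSpace {I : Type u} {X : I → Met.{u}} (hX : ∀ i, CompleteSpace (X i)) :
    CompleteSpace (MetCoprod X) := by
  refine EMetric.complete_of_cauchySeq_tendsto fun s hs => ?_
  rw [EMetric.cauchySeq_iff] at hs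
  obtain ⟨N, hN⟩ := hs ⊤ ENNReal.coe_lt_top
  have hidx : ∀ n, N ≤ n → ∃ y : X (s N).idx, s n = ⟨(s N).idx, y⟩ := fun n hn => by
    have h := MetCoprod.idx_eq_of_edist_ne_top (hN n hn N le_rfl).ne
    generalize s n = p at h ⊢
    obtain ⟨j, y⟩ := p
    dsimp only at h
    subst h
    exact ⟨y, rfl⟩
  choose y hy using fun k : ℕ => hidx (N + k) (Nat.le_add_right N k)
  have hc : CauchySeq y := EMetric.cauchySeq_iff.2 fun ε hε => by
    obtain ⟨M, hM⟩ := hs ε hε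
    refine ⟨M, fun m hm n hn => ?_⟩
    have := hM (N + m) (by omega) (N + n) (by omega)
    rwa [hy, hy, MetCoprod.edist_same] at this
  obtain ⟨a, ha⟩ := cauchySeq_tendsto_of_complete hc
  refine ⟨⟨_, a⟩, EMetric.tendsto_atTop.2 fun ε hε => ?_⟩
  obtain ⟨M, hM⟩ := EMetric.tendsto_atTop.1 ha ε hε
  refine ⟨N + M, fun n hn => ?_⟩
  obtain ⟨k, rfl⟩ := Nat.exists_eq_add_of_le ((Nat.le_add_right N M).trans hn)
  rw [hy, MetCoprod.edist_same]
  exact hM k (by omega)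

namespace HausdorffExpr

/-- If all constants of `e` are complete, then `e` denotes a functor preserving completeness. -/
theorem isComplete_obj (e : HausdorffExpr.{u}) (he : e.CompleteConstants) (X : Met.{u})
    (hX : Met.isComplete X) : Met.isComplete (e.functor.obj X) := by
  induction e generalizing X with
  | hausdorff =>
    have : CompleteSpace X := hX
    exact (inferInstance : CompleteSpace (TopologicalSpace.Compacts X))
  | const A => exact he
  | id => exact hX
  | prod I F ih => exact MetProd.completeSpace fun i => ih i (he i) X hX
  | coprod I F ih => exact MetCoprod.completeSpace fun i => ih i (he i) X hX
  | comp F G ihF ihG => exact ihF he.1 _ (ihG he.2 X hX)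

/-- The endofunctor of `CMS` denoted by an expression whose constants are complete: the restriction
of the endofunctor of `Met` which it denotes. -/
def functorCMS (e : HausdorffExpr.{u}) (he : e.CompleteConstants) : CMS.{u} ⥤ CMS.{u} :=
  Met.isComplete.lift (Met.isComplete.ι ⋙ e.functor)
    fun X => e.isComplete_obj he X.obj X.property

end HausdorffExpr

/-- An endofunctor of `CMS` is Hausdorff polynomial if it is (up to natural isomorphism) denoted by
an expression of the grammar in which all constants are complete. -/
def IsHausdorffPolynomialCMS (F : CMS.{u} ⥤ CMS.{u}) : Prop :=
  ∃ (e : HausdorffExpr.{u}) (he : e.CompleteConstants), Nonempty (F ≅ e.functorCMS he)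

end

/-!
An initial algebra for an endofunctor `F` of `Met` exists as soon as there is a small weakly initial
family of `F`-algebras: the product of the family has a least subalgebra, which maps to every
algebra, and uniquely so because two homomorphisms out of it agree on a subalgebra
(`hasInitial_of_weaklyInitial`).

Such a family exists if `F` is petty, that is, every element of `F X` is of the form `F g (t j)` for
one of a small family of elements `t j ∈ F (K j)` and a non-expanding map `g : K j → X`. Every
algebra then contains the subalgebra of all values of well-founded terms with operation symbols `j`
of arity `K j`, and it injects into the set of terms (`IsPetty.hasInitial`). A functor is petty if
it is bounded: every element of `F X` comes from a subspace of `X` with at most `κ` points.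
Hausdorff polynomial functors are bounded. For the Hausdorff functor this holds because compact
metric spaces have at most continuum many points; for composites it uses that Hausdorff polynomial
functors preserve isometric embeddings.

For complete spaces, let `A` be the initial algebra in `Met` and `i : A → Y` its completion.
Hausdorff polynomial functors also preserve density of the range, so `F A → F Y` is again a dense
isometric embedding. Hence the structure of `A` extends uniquely to an algebra structure on `Y`, and
the homomorphisms from `Y` to a complete algebra are the extensions of the homomorphisms from `A`,
of which there is exactly one. Completions are obtained as closures of images under the Kuratowski
embedding `x ↦ d(x, -)`, which takes values in a power of the extended half-line `[0, ∞]`.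
-/

noncomputable section

/-! ### Subspaces and projections -/

namespace Met

theorem map_map_apply (F : Met.{u} ⥤ Met.{u}) {X Y Z : Met.{u}} (f : X ⟶ Y) (g : Y ⟶ Z)
    (x : F.obj X) : F.map g (F.map f x) = F.map (f ≫ g) x :=
  (ConcreteCategory.congr_hom (F.map_comp f g) x).symm

/-- A subset of an extended metric space, as an object of `Met` with the restricted distance. -/
abbrev sub {X : Met.{u}} (S : Set X) : Met.{u} := Met.of S

/-- The inclusion of a subspace. -/
def incl {X : Met.{u}} (S : Set X) : sub S ⟶ X :=
  ConcreteCategory.ofHom ⟨Subtype.val, fun _ _ => le_rfl⟩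

/-- The corestriction of a non-expanding map to a subspace containing its range. -/
def corestrict {X Y : Met.{u}} (f : Y ⟶ X) {S : Set X} (h : ∀ y, f y ∈ S) : Y ⟶ sub S :=
  ConcreteCategory.ofHom ⟨fun y => ⟨f y, h y⟩, fun y y' => edist_le f y y'⟩

/-- The inclusion between two nested subspaces. -/
def inclLE {X : Met.{u}} {S T : Set X} (h : S ⊆ T) : sub S ⟶ sub T :=
  corestrict (incl S) fun x => h x.2

theorem inclLE_incl {X : Met.{u}} {S T : Set X} (h : S ⊆ T) : inclLE h ≫ incl T = incl S := rfl

theorem isometry_incl {X : Met.{u}} (S : Set X) : Isometry (incl S) := fun _ _ => rfl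

/-- An extended metric space whose points inject into a type `W` is isomorphic to one carried by a
subset of `W`. Up to isomorphism, such spaces therefore form a small family. -/
theorem exists_iso_of_injective {X : Met.{u}} {W : Type u} (f : X → W)
    (hf : Function.Injective f) :
    ∃ (V : Set W) (m : EMetricSpace V), Nonempty (X ≅ @Met.of V m) := by
  let e : X ≃ Set.range f := Equiv.ofInjective f hf
  let m : EMetricSpace (Set.range f) := EMetricSpace.induced e.symm e.symm.injective inferInstance
  refine ⟨Set.range f, m, ⟨⟨ConcreteCategory.ofHom (Y := @Met.of _ m) ⟨e, fun x y => ?_⟩,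
    ConcreteCategory.ofHom (X := @Met.of _ m) ⟨e.symm, fun _ _ => le_rfl⟩, ?_, ?_⟩⟩⟩
  · change edist (e.symm (e x)) (e.symm (e y)) ≤ _
    simp
  · exact ConcreteCategory.hom_ext _ _ fun x => e.symm_apply_apply x
  · exact ConcreteCategory.hom_ext _ _ fun x => e.apply_symm_apply x

end Met

/-- The projections out of a product of extended metric spaces. -/
def MetProd.proj {J : Type u} (X : J → Met.{u}) (j : J) : Met.of (MetProd X) ⟶ X j :=
  ConcreteCategory.ofHom ⟨fun p => p.val j, fun p q => MetProd.edist_val_le p q j⟩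

/-! ### Algebras for endofunctors of `Met` -/

namespace CategoryTheory.Endofunctor.Algebra

variable {F : Met.{u} ⥤ Met.{u}}

/-- A set of elements of an algebra which is closed under the algebra structure, i.e. the carrier
of a subalgebra. -/
def IsClosedUnder (B : Algebra F) (S : Set B.a) : Prop :=
  ∀ x : F.obj (Met.sub S), B.str (F.map (Met.incl S) x) ∈ S

/-- The algebra carried by a closed subset of an algebra. -/
def subalgebra (B : Algebra F) (S : Set B.a) (hS : IsClosedUnder B S) : Algebra F where
  a := Met.sub S
  str := Met.corestrict (F.map (Met.incl S) ≫ B.str) hS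

/-- The inclusion of a subalgebra. -/
def subalgebraIncl (B : Algebra F) (S : Set B.a) (hS : IsClosedUnder B S) :
    subalgebra B S hS ⟶ B :=
  { f := Met.incl S, h := rfl }

/-- The least subset closed under the algebra structure. -/
def leastClosed (B : Algebra F) : Set B.a := ⋂₀ {S | IsClosedUnder B S}

theorem leastClosed_subset {B : Algebra F} {S : Set B.a} (hS : IsClosedUnder B S) :
    leastClosed B ⊆ S := Set.sInter_subset_of_mem hS

theorem isClosedUnder_leastClosed (B : Algebra F) : IsClosedUnder B (leastClosed B) := by
  refine fun x => Set.mem_sInter.2 fun S hS => ?_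
  have h := hS (F.map (Met.inclLE (leastClosed_subset hS)) x)
  rwa [Met.map_map_apply, Met.inclLE_incl] at h

/-- Homomorphisms out of the least subalgebra are unique, since two of them agree on a closed
subset. -/
theorem hom_ext_leastClosed {B C : Algebra F}
    (h k : subalgebra B (leastClosed B) (isClosedUnder_leastClosed B) ⟶ C) : h = k := by
  -- The equalizer of `h` and `k`, as a subset of `B`.
  let E : Set B.a := {p | ∃ hp : p ∈ leastClosed B, h.f ⟨p, hp⟩ = k.f ⟨p, hp⟩}
  have hE : E ⊆ leastClosed B := fun p hp => hp.1
  have hc : IsClosedUnder B E := by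
    intro x
    let y := F.map (Met.inclLE hE) x
    have hy : F.map (Met.incl E) x = F.map (Met.incl _) y := by
      rw [Met.map_map_apply, Met.inclLE_incl]
    rw [hy]
    refine ⟨isClosedUnder_leastClosed B y, ?_⟩
    have hhk : Met.inclLE hE ≫ h.f = Met.inclLE hE ≫ k.f :=
      ConcreteCategory.hom_ext _ _ fun p => p.2.2
    refine (ConcreteCategory.congr_hom h.h y).symm.trans
      (Eq.trans ?_ (ConcreteCategory.congr_hom k.h y))
    have hF : F.map h.f y = F.map k.f y :=
      (Met.map_map_apply F (Met.inclLE hE) h.f x).trans <|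
        (congrArg (fun g => F.map g x) hhk).trans (Met.map_map_apply F (Met.inclLE hE) k.f x).symm
    exact congrArg C.str hF
  exact Algebra.ext (ConcreteCategory.hom_ext _ _ fun p => (leastClosed_subset hc p.2).2)

/-- The product of a small family of algebras. -/
def prod {J : Type u} (A : J → Algebra F) : Algebra F where
  a := Met.of (MetProd fun j => (A j).a)
  str := ConcreteCategory.ofHom
    { toFun := fun x => ⟨fun j => (A j).str (F.map (MetProd.proj _ j) x)⟩
      edist_le' := fun x y => iSup_le fun j =>
        (Met.edist_le (A j).str _ _).trans (Met.edist_le (F.map _) x y) }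

/-- The projections out of the product of algebras. -/
def prodProj {J : Type u} (A : J → Algebra F) (j : J) : prod A ⟶ A j where
  f := MetProd.proj _ j
  h := rfl

/-- A small weakly initial family of algebras yields an initial algebra: the least subalgebra of
the product of the family. -/
theorem hasInitial_of_weaklyInitial {J : Type u} (A : J → Algebra F)
    (hA : ∀ B : Algebra F, ∃ j, Nonempty (A j ⟶ B)) : HasInitial (Algebra F) := by
  choose j hj using hA
  exact (IsInitial.ofUniqueHom (X := subalgebra (prod A) _ (isClosedUnder_leastClosed _))
    (fun B => subalgebraIncl _ _ _ ≫ prodProj A (j B) ≫ (hj B).some)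
    fun B h => hom_ext_leastClosed _ _).hasInitial

end CategoryTheory.Endofunctor.Algebra

/-! ### Petty functors -/

section Petty

open Endofunctor Endofunctor.Algebra

variable {F : Met.{u} ⥤ Met.{u}}

/-- An endofunctor of `Met` is petty if, on underlying sets, it is a quotient of a small coproduct
of representable functors `K j ⟶ -`; by the Yoneda lemma the quotient map is given by elements
`t j` of `F (K j)`. -/
def IsPetty (F : Met.{u} ⥤ Met.{u}) : Prop :=
  ∃ (J : Type u) (K : J → Met.{u}) (t : ∀ j, F.obj (K j)),
    ∀ (X : Met.{u}) (x : F.obj X), ∃ (j : J) (g : K j ⟶ X), F.map g (t j) = x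

/-- `Evaluates t B w b` says that `b` is the value in the algebra `B` of the well-founded term `w`
with operation symbols `j : J` of arity `K j`. Evaluation is partial: a term `WType.mk j f` has a
value only if the values of the subterms `f k` depend on `k : K j` in a non-expanding way. -/
inductive Evaluates {J : Type u} {K : J → Met.{u}} (t : ∀ j, F.obj (K j)) (B : Algebra F) :
    WType (fun j => (K j : Type u)) → B.a → Prop
  | mk (j : J) (f : K j → WType fun j => (K j : Type u)) (g : K j ⟶ B.a)
      (h : ∀ k, Evaluates t B (f k) (g k)) :
      Evaluates t B (WType.mk j f) (B.str (F.map g (t j)))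

theorem Evaluates.unique {J : Type u} {K : J → Met.{u}} {t : ∀ j, F.obj (K j)} {B : Algebra F}
    {w : WType fun j => (K j : Type u)} {b b' : B.a} (h : Evaluates t B w b)
    (h' : Evaluates t B w b') : b = b' := by
  induction h generalizing b' with
  | mk j f g h ih =>
    cases h' with
    | mk _ _ g' h' =>
      obtain rfl : g = g' := ConcreteCategory.hom_ext _ _ fun k => ih k (h' k)
      rfl

/-- Every petty endofunctor of `Met` has an initial algebra: the values of terms in an algebra form
a subalgebra which injects into the set of terms, so algebras carried by sets of terms form a weakly
initial family. -/
theorem IsPetty.hasInitial (hF : IsPetty F) : HasInitial (Algebra F) := by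
  obtain ⟨J, K, t, hF⟩ := hF
  let W := WType fun j => (K j : Type u)
  let I := Σ (V : Set W) (m : EMetricSpace V), (F.obj (@Met.of V m) ⟶ @Met.of V m)
  refine hasInitial_of_weaklyInitial (J := I) (fun i => ⟨@Met.of i.1 i.2.1, i.2.2⟩) fun B => ?_
  -- The values of terms form a subalgebra, which is then copied onto a set `V` of terms.
  let S : Set B.a := {b | ∃ w, Evaluates t B w b}
  have hS : IsClosedUnder B S := by
    intro x
    obtain ⟨j, g, rfl⟩ := hF _ x
    choose f hf using fun k => (g k).2
    refine ⟨WType.mk j f, ?_⟩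
    rw [Met.map_map_apply]
    exact Evaluates.mk j f (g ≫ Met.incl S) hf
  choose w hw using fun b : S => b.2
  obtain ⟨V, m, ⟨e⟩⟩ := Met.exists_iso_of_injective (X := (subalgebra B S hS).a) w fun b b' h =>
    Subtype.ext ((hw b).unique (h ▸ hw b'))
  let A : Algebra F := ⟨@Met.of V m, F.map e.inv ≫ (subalgebra B S hS).str ≫ e.hom⟩
  let φ : A ⟶ subalgebra B S hS :=
    { f := e.inv
      h := by simp only [A, Category.assoc, e.hom_inv_id, Category.comp_id] }
  exact ⟨⟨V, m, A.str⟩, ⟨φ ≫ subalgebraIncl B S hS⟩⟩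

end Petty

/-! ### Isometric embeddings -/

namespace HausdorffExpr

/-- Hausdorff polynomial functors preserve isometric embeddings. -/
theorem isometry_map (e : HausdorffExpr.{u}) {X Y : Met.{u}} (f : X ⟶ Y) (hf : Isometry f) :
    Isometry (e.functor.map f) := by
  induction e generalizing X Y with
  | hausdorff => exact fun S T => Metric.hausdorffEDist_image hf
  | const A => exact fun _ _ => rfl
  | id => exact hf
  | prod I F ih => exact fun x y => iSup_congr fun i => ih i f hf (x.val i) (y.val i)
  | coprod I F ih =>
    rintro ⟨i, x⟩ ⟨j, y⟩
    by_cases h : i = j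
    · subst h
      exact (MetCoprod.edist_same i _ _).trans
        ((ih i f hf x y).trans
          (MetCoprod.edist_same (X := fun i => (F i).functor.obj X) i x y).symm)
    · exact (MetCoprod.edist_ne h _ _).trans
        (MetCoprod.edist_ne (X := fun i => (F i).functor.obj X) h x y).symm
  | comp F G ihF ihG => exact ihF _ (ihG f hf)

end HausdorffExpr

/-! ### Bounded functors -/

section Bounded

open Cardinal

/-- An endofunctor of `Met` is bounded by a cardinal `κ` if every element of `F X` comes from `F T`
for some subspace `T` of `X` with at most `κ` points. -/
def IsBoundedBy (F : Met.{u} ⥤ Met.{u}) (κ : Cardinal.{u}) : Prop :=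
  ∀ (X : Met.{u}) (x : F.obj X), ∃ T : Set X, #T ≤ κ ∧ x ∈ Set.range (F.map (Met.incl T))

theorem Met.range_map_incl_mono (F : Met.{u} ⥤ Met.{u}) {X : Met.{u}} {S T : Set X} (h : S ⊆ T) :
    Set.range (F.map (Met.incl S)) ⊆ Set.range (F.map (Met.incl T)) := by
  rintro _ ⟨x, rfl⟩
  exact ⟨F.map (Met.inclLE h) x, Met.map_map_apply F _ _ x⟩

/-- A bounded functor is petty, since the metric spaces with at most `κ` points form a small family
up to isomorphism. -/
theorem IsBoundedBy.isPetty {F : Met.{u} ⥤ Met.{u}} {κ : Cardinal.{u}} (hF : IsBoundedBy F κ) :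
    IsPetty F := by
  refine ⟨Σ (V : Set κ.out) (m : EMetricSpace V), F.obj (@Met.of V m),
    fun i => @Met.of i.1 i.2.1, fun i => i.2.2, fun X x => ?_⟩
  obtain ⟨T, hT, t, rfl⟩ := hF X x
  rw [← Cardinal.mk_out κ] at hT
  obtain ⟨f⟩ := Cardinal.le_def _ _ |>.1 hT
  obtain ⟨V, m, ⟨e⟩⟩ := Met.exists_iso_of_injective (X := Met.sub T) f f.injective
  refine ⟨⟨V, m, F.map e.hom t⟩, e.inv ≫ Met.incl T, ?_⟩
  exact (Met.map_map_apply F e.hom _ t).trans (by rw [e.hom_inv_id_assoc])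

/-- A compact subset of an extended metric space is separable, and each of its points is the limit
of a sequence in a countable dense subset. -/
theorem IsCompact.mk_le_continuum {X : Type u} [EMetricSpace X] {S : Set X} (hS : IsCompact S) :
    #S ≤ 𝔠 := by
  have : CompactSpace S := isCompact_iff_compactSpace.1 hS
  obtain ⟨D, hD, hd⟩ := TopologicalSpace.exists_countable_dense S
  choose s hs ht using fun x : S => mem_closure_iff_seq_limit.1 (hd x)
  have hinj : Function.Injective fun (x : S) (n : ℕ) => (⟨s x n, hs x n⟩ : D) := by
    intro x y h
    have hxy : s x = s y := funext fun n => congrArg Subtype.val (congrFun h n)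
    exact tendsto_nhds_unique (ht x) (hxy ▸ ht y)
  calc #S ≤ #(ℕ → D) := Cardinal.mk_le_of_injective hinj
    _ = #D ^ ℵ₀ := by simp
    _ ≤ ℵ₀ ^ ℵ₀ := Cardinal.power_le_power_right hD.le_aleph0
    _ = 𝔠 := Cardinal.aleph0_power_aleph0

/-- Boundedness of a composite: an element of `F (G X)` comes from `F T` with `T ⊆ G X` small, and
the elements of `T` come from `G U` for a common small `U ⊆ X`. The resulting map `T → G U` is
non-expanding because `G` turns the inclusion of `U` into an isometric embedding. -/
theorem IsBoundedBy.comp {F G : Met.{u} ⥤ Met.{u}} {κ μ : Cardinal.{u}} (hF : IsBoundedBy F κ)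
    (hG : IsBoundedBy G μ)
    (hi : ∀ {X Y : Met.{u}} (f : X ⟶ Y), Isometry f → Isometry (G.map f)) :
    IsBoundedBy (G ⋙ F) (κ * μ) := by
  intro X x
  obtain ⟨T, hT, t, rfl⟩ := hF (G.obj X) x
  choose S hS hmem using fun p : T => hG X p
  let U : Set X := ⋃ p, S p
  choose s hs using fun p : T => Met.range_map_incl_mono G (Set.subset_iUnion S p) (hmem p)
  let g : Met.sub T ⟶ G.obj (Met.sub U) := ConcreteCategory.ofHom ⟨s, fun p q => by
    rw [← hi _ (Met.isometry_incl U), hs, hs]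
    exact le_rfl⟩
  have hg : g ≫ G.map (Met.incl U) = Met.incl T := ConcreteCategory.hom_ext _ _ hs
  refine ⟨U, ?_, F.map g t, ?_⟩
  · calc #U ≤ #T * ⨆ p, #(S p) := Cardinal.mk_iUnion_le S
      _ ≤ κ * μ := mul_le_mul' hT (ciSup_le' hS)
  · exact (Met.map_map_apply F g _ t).trans (by rw [hg])

/-- Every Hausdorff polynomial functor is bounded: the Hausdorff functor by the continuum, constant
functors by `0`, the identity by `1`, products and coproducts by the sum of the bounds of the
components, and composites by the product of the two bounds. -/
theorem HausdorffExpr.exists_isBoundedBy (e : HausdorffExpr.{u}) :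
    ∃ κ, IsBoundedBy e.functor κ := by
  induction e with
  | hausdorff =>
    -- A compact set `S` is the direct image of the whole space `S` under its inclusion.
    refine ⟨𝔠, fun X (S : TopologicalSpace.Compacts X) => ⟨(S : Set X),
      S.isCompact.mk_le_continuum,
      (⟨Set.univ, isCompact_iff_isCompact_univ.1 S.isCompact⟩ :
        TopologicalSpace.Compacts (S : Set X)), ?_⟩⟩
    exact TopologicalSpace.Compacts.ext (Subtype.coe_image_univ (S : Set X))
  | const A => exact ⟨0, fun X x => ⟨∅, by simp, x, rfl⟩⟩
  | id => exact ⟨1, fun X x => ⟨({x} : Set X), (Cardinal.mk_singleton x).le, ⟨x, rfl⟩, rfl⟩⟩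
  | prod I F ih =>
    choose κ hκ using ih
    refine ⟨Cardinal.sum κ, fun X x => ?_⟩
    choose T hT hx using fun i => hκ i X (x.val i)
    choose t ht using fun i =>
      Met.range_map_incl_mono (F i).functor (Set.subset_iUnion T i) (hx i)
    exact ⟨⋃ i, T i, (Cardinal.mk_iUnion_le_sum_mk).trans (Cardinal.sum_le_sum _ _ hT), ⟨t⟩,
      MetProd.ext (funext ht)⟩
  | coprod I F ih =>
    choose κ hκ using ih
    refine ⟨Cardinal.sum κ, fun X ⟨i, x⟩ => ?_⟩
    obtain ⟨T, hT, t, rfl⟩ := hκ i X x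
    exact ⟨T, hT.trans (Cardinal.le_sum κ i), ⟨i, t⟩, rfl⟩
  | comp F G ihF ihG =>
    obtain ⟨κ, hκ⟩ := ihF
    obtain ⟨μ, hμ⟩ := ihG
    exact ⟨κ * μ, hκ.comp hμ G.isometry_map⟩

end Bounded

/-! ### Dense maps -/

theorem denseRange_iff_edist {X Y : Type*} [EMetricSpace Y] {f : X → Y} :
    DenseRange f ↔ ∀ y, ∀ ε > 0, ∃ x, edist y (f x) < ε := by
  simp [DenseRange, Dense, EMetric.mem_closure_iff]

/-- Direct images along a map with dense range are dense among the compact subsets: a compact set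
is approximated by a finite set of points, and these are approximated by points in the range. -/
theorem denseRange_hausdorffFunctor_map {X Y : Met.{u}} (f : X ⟶ Y) (hf : DenseRange f) :
    DenseRange (hausdorffFunctor.map f) := by
  refine denseRange_iff_edist.2 fun (S : TopologicalSpace.Compacts Y) ε hε => ?_
  obtain ⟨δ, hδ, hδε⟩ := exists_between hε
  obtain ⟨t, htS, htf, hcov⟩ := EMetric.totallyBounded_iff'.1 S.isCompact.totallyBounded (δ / 2)
    (ENNReal.half_pos hδ.ne')
  choose g hg using fun y => denseRange_iff_edist.1 hf y (δ / 2) (ENNReal.half_pos hδ.ne')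
  refine ⟨(⟨g '' t, (htf.image g).isCompact⟩ : TopologicalSpace.Compacts X),
    lt_of_le_of_lt ?_ hδε⟩
  change Metric.hausdorffEDist (S : Set Y) (f '' (g '' t)) ≤ δ
  refine Metric.hausdorffEDist_le_of_mem_edist (fun y hy => ?_) ?_
  · obtain ⟨z, hz, hyz⟩ := Set.mem_iUnion₂.1 (hcov hy)
    refine ⟨f (g z), Set.mem_image_of_mem f (Set.mem_image_of_mem g hz), ?_⟩
    calc edist y (f (g z)) ≤ edist y z + edist z (f (g z)) := edist_triangle _ _ _
      _ ≤ δ / 2 + δ / 2 := add_le_add (le_of_lt hyz) (hg z).le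
      _ = δ := ENNReal.add_halves δ
  · rintro _ ⟨_, ⟨z, hz, rfl⟩, rfl⟩
    refine ⟨z, htS hz, ?_⟩
    rw [edist_comm]
    exact (hg z).le.trans ENNReal.half_le_self

/-- Hausdorff polynomial functors preserve maps with dense range. -/
theorem HausdorffExpr.denseRange_map (e : HausdorffExpr.{u}) {X Y : Met.{u}} (f : X ⟶ Y)
    (hf : DenseRange f) : DenseRange (e.functor.map f) := by
  induction e generalizing X Y with
  | hausdorff => exact denseRange_hausdorffFunctor_map f hf
  | const A => exact Function.surjective_id.denseRange
  | id => exact hf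
  | prod I F ih =>
    refine denseRange_iff_edist.2 fun y ε hε => ?_
    obtain ⟨δ, hδ, hδε⟩ := exists_between hε
    choose x hx using fun i => denseRange_iff_edist.1 (ih i f hf) (y.val i) δ hδ
    exact ⟨⟨x⟩, lt_of_le_of_lt (iSup_le fun i => (hx i).le) hδε⟩
  | coprod I F ih =>
    refine denseRange_iff_edist.2 fun ⟨i, y⟩ ε hε => ?_
    obtain ⟨x, hx⟩ := denseRange_iff_edist.1 (ih i f hf) y ε hε
    exact ⟨⟨i, x⟩, (MetCoprod.edist_same (X := fun i => (F i).functor.obj Y) i y _).trans_lt hx⟩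
  | comp F G ihF ihG => exact ihF _ (ihG f hf)

namespace Met

theorem hom_ext_of_denseRange {X Y Z : Met.{u}} {i : X ⟶ Y} (hi : DenseRange i) {g h : Y ⟶ Z}
    (w : i ≫ g = i ≫ h) : g = h :=
  ConcreteCategory.hom_ext _ _ <| congrFun <|
    hi.equalizer (continuous g) (continuous h) (funext (ConcreteCategory.congr_hom w))

/-- A non-expanding map into a complete space extends along a dense isometric embedding. -/
theorem exists_extension {X Y Z : Met.{u}} {i : X ⟶ Y} (hi : Isometry i) (hd : DenseRange i)
    [CompleteSpace Z] (f : X ⟶ Z) : ∃ g : Y ⟶ Z, i ≫ g = f := by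
  have hf : UniformContinuous f := f.hom'.lipschitz.uniformContinuous
  let ψ := (hi.isUniformInducing.isDenseInducing hd).extend f
  have hψ : Continuous ψ :=
    (uniformContinuous_uniformly_extend hi.isUniformInducing hd hf).continuous
  have hψi : ∀ x, ψ (i x) = f x := uniformly_extend_of_ind hi.isUniformInducing hd hf
  refine ⟨ConcreteCategory.ofHom ⟨ψ, fun y y' => ?_⟩, ConcreteCategory.hom_ext _ _ hψi⟩
  refine hd.induction_on₂ (p := fun y y' => edist (ψ y) (ψ y') ≤ edist y y') ?_ ?_ y y'
  · exact isClosed_le ((hψ.comp continuous_fst).edist (hψ.comp continuous_snd))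
      (continuous_fst.edist continuous_snd)
  · intro x x'
    rw [hψi, hψi, hi.edist_eq]
    exact edist_le f x x'

end Met

/-! ### Completion -/

/-- A disjoint union of two real lines, indexed by the truth values. It is a complete space which
contains the extended half-line `[0, ∞]`, where finite numbers have distance `|a - b|` and `∞` is
at infinite distance from them. -/
abbrev ExtendedLine : Met.{u} := Met.of (MetCoprod fun _ : ULift.{u} Prop => Met.of (ULift.{u} ℝ))

/-- The embedding of `[0, ∞]` into `ExtendedLine`: finite numbers lie on the line indexed by `False`
and `∞` is the point `0` (its `toReal`) of the line indexed by `True`. -/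
def ENNReal.toExtendedLine (a : ℝ≥0∞) : ExtendedLine.{u} := ⟨⟨a = ⊤⟩, ⟨a.toReal⟩⟩

theorem toExtendedLine_coe (r : NNReal) :
    (r : ℝ≥0∞).toExtendedLine = (⟨⟨False⟩, ⟨(r : ℝ)⟩⟩ : ExtendedLine.{u}) := by
  simp [ENNReal.toExtendedLine]

theorem edist_toExtendedLine_le {a b c : ℝ≥0∞} (hab : a ≤ b + c) (hba : b ≤ a + c) :
    edist a.toExtendedLine b.toExtendedLine ≤ c := by
  induction c with
  | top => exact le_top
  | coe c =>
    induction a with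
    | top =>
      obtain rfl : b = ⊤ := by simpa using hab
      simp
    | coe a =>
      induction b with
      | top => simp at hba
      | coe b =>
        norm_cast at hab hba
        rw [toExtendedLine_coe, toExtendedLine_coe, MetCoprod.edist_same]
        change edist (a : ℝ) (b : ℝ) ≤ c
        rw [edist_nndist, ENNReal.coe_le_coe, ← NNReal.coe_le_coe, coe_nndist, Real.dist_eq,
          abs_sub_le_iff]
        rw [← NNReal.coe_le_coe, NNReal.coe_add] at hab hba
        constructor <;> linarith

theorem edist_toExtendedLine_zero (a : ℝ≥0∞) :
    edist a.toExtendedLine (0 : ℝ≥0∞).toExtendedLine = a := by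
  induction a with
  | top => exact MetCoprod.edist_ne (by simp) _ _
  | coe a =>
    rw [toExtendedLine_coe, ← ENNReal.coe_zero, toExtendedLine_coe, MetCoprod.edist_same]
    change edist (a : ℝ) ((0 : NNReal) : ℝ) = a
    rw [edist_nndist, ENNReal.coe_inj]
    ext
    simp

/-- The Kuratowski embedding `x ↦ edist x ·` of an extended metric space. -/
def Met.kuratowski (X : Met.{u}) : X ⟶ Met.of (MetProd fun _ : X => ExtendedLine.{u}) :=
  ConcreteCategory.ofHom
    { toFun := fun x => ⟨fun z => (edist x z).toExtendedLine⟩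
      edist_le' := fun x y => iSup_le fun z => edist_toExtendedLine_le
        ((edist_triangle x y z).trans (add_comm _ _).le)
        ((edist_triangle y x z).trans (by rw [add_comm, edist_comm x y])) }

theorem Met.isometry_kuratowski (X : Met.{u}) : Isometry X.kuratowski := by
  refine fun x y => le_antisymm (Met.edist_le _ x y) ?_
  refine le_trans ?_ (MetProd.edist_val_le _ _ y)
  change _ ≤ edist (edist x y).toExtendedLine (edist y y).toExtendedLine
  rw [edist_self y, edist_toExtendedLine_zero]

/-- Every extended metric space has a completion: the closure of its image under the Kuratowski
embedding. -/
theorem Met.exists_completion (X : Met.{u}) :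
    ∃ (Y : Met.{u}) (i : X ⟶ Y), CompleteSpace Y ∧ Isometry i ∧ DenseRange i := by
  have hc : CompleteSpace (MetProd fun _ : X => ExtendedLine.{u}) :=
    MetProd.completeSpace fun _ => MetCoprod.completeSpace fun _ =>
      inferInstanceAs (CompleteSpace (ULift ℝ))
  let C := closure (Set.range X.kuratowski)
  refine ⟨Met.sub (X := Met.of (MetProd fun _ : X => ExtendedLine.{u})) C,
    Met.corestrict X.kuratowski fun x => subset_closure ⟨x, rfl⟩,
    isClosed_closure.completeSpace_coe, fun x y => X.isometry_kuratowski x y, ?_⟩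
  refine denseRange_iff_edist.2 fun y ε hε => ?_
  obtain ⟨_, ⟨x, rfl⟩, hx⟩ := EMetric.mem_closure_iff.1 y.2 ε hε
  exact ⟨x, hx⟩

/-! ### Initial algebras -/

open Endofunctor

theorem HausdorffExpr.hasInitial_algebra (e : HausdorffExpr.{u}) :
    HasInitial (Algebra e.functor) := by
  obtain ⟨κ, hκ⟩ := e.exists_isBoundedBy
  exact hκ.isPetty.hasInitial

/-- The completion of the initial algebra in `Met` is an initial algebra in `CMS`: its structure,
and the homomorphisms into complete algebras, are the unique extensions along dense isometric
embeddings. -/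
theorem HausdorffExpr.hasInitial_algebra_functorCMS (e : HausdorffExpr.{u})
    (he : e.CompleteConstants) : HasInitial (Algebra (e.functorCMS he)) := by
  have := e.hasInitial_algebra
  let A : Algebra e.functor := ⊥_ _
  obtain ⟨Y, i, hY, hi, hd⟩ := A.a.exists_completion
  obtain ⟨s, hs⟩ := Met.exists_extension (e.isometry_map i hi) (e.denseRange_map i hd) (A.str ≫ i)
  let C : Algebra (e.functorCMS he) := ⟨⟨Y, hY⟩, ObjectProperty.homMk s⟩
  -- The restricted functor acts on underlying spaces as `e.functor`.
  let U (B : Algebra (e.functorCMS he)) : Algebra e.functor := ⟨B.a.obj, B.str.hom⟩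
  have hex : ∀ B, Nonempty (C ⟶ B) := by
    intro B
    have : CompleteSpace B.a.obj := B.a.property
    let h : A ⟶ U B := initial.to _
    obtain ⟨g, hg⟩ := Met.exists_extension hi hd h.f
    refine ⟨⟨ObjectProperty.homMk g, ObjectProperty.hom_ext _ ?_⟩⟩
    refine Met.hom_ext_of_denseRange (e.denseRange_map i hd) ?_
    calc e.functor.map i ≫ e.functor.map g ≫ (U B).str = e.functor.map h.f ≫ (U B).str := by
          rw [← Functor.map_comp_assoc, hg]
      _ = A.str ≫ h.f := h.h
      _ = e.functor.map i ≫ s ≫ g := by rw [reassoc_of% hs, hg]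
  have huniq : ∀ (B : Algebra (e.functorCMS he)) (g g' : C ⟶ B), g = g' := by
    intro B g g'
    let r (g : C ⟶ B) : A ⟶ U B :=
      { f := i ≫ g.f.hom
        h := by
          have hg : e.functor.map g.f.hom ≫ B.str.hom = s ≫ g.f.hom :=
            congrArg InducedCategory.Hom.hom g.h
          rw [Functor.map_comp, Category.assoc]
          exact (congrArg (e.functor.map i ≫ ·) hg).trans (by rw [reassoc_of% hs]) }
    have hr : r g = r g' := initial.hom_ext _ _
    exact Algebra.ext (ObjectProperty.hom_ext _
      (Met.hom_ext_of_denseRange hd (congrArg Algebra.Hom.f hr)))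
  exact (IsInitial.ofUniqueHom (fun B => (hex B).some) fun B h => huniq B h _).hasInitial

end

theorem corollaryC :
    (∀ F : Met.{u} ⥤ Met.{u}, IsHausdorffPolynomial F →
      HasInitial (Endofunctor.Algebra F)) ∧
    (∀ F : CMS.{u} ⥤ CMS.{u}, IsHausdorffPolynomialCMS F →
      HasInitial (Endofunctor.Algebra F)) := by
  refine ⟨?_, ?_⟩
  · rintro F ⟨e, ⟨α⟩⟩
    have := e.hasInitial_algebra
    exact Adjunction.hasColimitsOfShape_of_equivalence (Endofunctor.Algebra.equivOfNatIso α).functor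
  · rintro F ⟨e, he, ⟨α⟩⟩
    have := e.hasInitial_algebra_functorCMS he
    exact Adjunction.hasColimitsOfShape_of_equivalence (Endofunctor.Algebra.equivOfNatIso α).functor
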